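/- For $n\ge 0$, the Aztec diamond graph $AD_n$ of order $n$ has as vertices the integer points $(p,q)$ with $0\le p,q\le 2n$ and $p+q$ odd ($p$ is the height measured downwards from the top, $q$ the horizontal position measured from the left), two of them being adjacent if and only if they are opposite corners of a unit square. The centers of its edges form a $2n\times 2n$ array; the edge whose center lies in row $i$ and column $j$ of this array ($1\le i,j\le 2n$, rows numbered from top to bottom, columns from left to right) is the one joining two corners of the unit square $[i-1,i]\times[j-1,j]$. For a $4\times 4$ matrix $B=(B_{s,t})_{1\le s,t\le 4}$, let $\mathrm{wt}_B$ be the edge weighting obtained by filling this array periodically with copies of $B$, starting in the upper left corner: the edge in position $(i,j)$ has weight $B_{s,t}$, where $s,t\in\{1,2,3,4\}$, $s\equiv i$ and $t\equiv j \pmod 4$. Let $M(AD_n(\mathrm{wt}_B))$ be the matching generating function, i.e. the sum over all perfect matchings of $AD_n$ of the product of the weights of the edges in the matching (so that it equals $1$ for $n=0$). **Theorem.** Let $a,b,c,d$ be positive real numbers, let $$B=\begin{bmatrix}a&b&c&d\\ b&a&d&c\\ d&c&b&a\\ c&d&a&b\end{bmatrix}$$ and $P=ab(c^2+d^2)^2+cd(a^2+b^2)^2$.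 Then for every integer $k\ge 0$, $$\begin{aligned} M(AD_{4k}(\mathrm{wt}_B))&=P^{k(2k+1)}(ab+cd)^{k(2k-1)},\\ M(AD_{4k+1}(\mathrm{wt}_B))&=(a^2+b^2)\,P^{k(2k+2)}(ab+cd)^{2k^2},\\ M(AD_{4k+2}(\mathrm{wt}_B))&=P^{k(2k+3)+1}(ab+cd)^{k(2k+1)},\\ M(AD_{4k+3}(\mathrm{wt}_B))&=P^{k(2k+4)+2}(ab+cd)^{k(2k+2)}. \end{aligned}$$ -/

import Mathlib

/-- A set `M` of edges of `G` is a perfect matching if every vertex of `G` is incident to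
precisely one edge in `M`. -/
def IsPerfectMatchingEdges {V : Type*} (G : SimpleGraph V) (M : Finset (Sym2 V)) : Prop :=
  (∀ e ∈ M, e ∈ G.edgeSet) ∧ ∀ v : V, ∃! e, e ∈ M ∧ v ∈ e

open scoped Classical in
/-- The matching generating function of a finite graph with edge weights `wt`: the sum over all
perfect matchings of the product of the weights of the edges in the matching. (Values of `wt`
off the edges of `G` play no role.) -/
noncomputable def matchingGenFun {V : Type*} [Fintype V] (G : SimpleGraph V)
    (wt : Sym2 V → ℝ) : ℝ :=
  ∑ M : Finset (Sym2 V) with IsPerfectMatchingEdges G M, ∏ e ∈ M, wt e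

/-- Vertices of the Aztec diamond graph of order `n`, drawn with its edges along diagonals of
unit squares: the points `(p, q)`, `0 ≤ p, q ≤ 2n`, with `p + q` odd. Here `p` is the height
counted downwards from the top and `q` is the horizontal position counted from the left. -/
abbrev AztecVertex (n : ℕ) : Type :=
  {v : Fin (2 * n + 1) × Fin (2 * n + 1) // Odd (v.1.val + v.2.val)}

namespace AztecVertex

/-- Vertical coordinate (downwards). -/
def row {n : ℕ} (v : AztecVertex n) : ℕ := v.1.1.val

/-- Horizontal coordinate (to the right). -/
def col {n : ℕ} (v : AztecVertex n) : ℕ := v.1.2.val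

end AztecVertex

/-- The Aztec diamond graph of order `n`: two vertices are adjacent iff they are opposite corners
of a unit square. Each of the `2n × 2n` unit squares of `[0, 2n]²` has exactly one
diagonal joining two vertices, so the centers of the edges form a `2n × 2n` array. -/
def aztecDiamond (n : ℕ) : SimpleGraph (AztecVertex n) where
  Adj u v := (u.row = v.row + 1 ∨ v.row = u.row + 1) ∧ (u.col = v.col + 1 ∨ v.col = u.col + 1)
  symm := ⟨fun _ _ h => ⟨h.1.symm, h.2.symm⟩⟩
  loopless := ⟨fun _ h => by rcases h.1 with h | h <;> omega⟩

/-- The periodic extension of a `k × l` matrix to a quarter-infinite array (rows downwards,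
columns to the right, both numbered from `0`), with a copy of `A` in the upper left corner. -/
def periodicArray {k l : ℕ} [NeZero k] [NeZero l] (A : Matrix (Fin k) (Fin l) ℝ) (i j : ℕ) : ℝ :=
  A (Fin.ofNat k i) (Fin.ofNat l j)

/-- The weight `wt_A` on the edges of the Aztec diamond graph with weight pattern `A`: the edge
which is a diagonal of the unit square `[i, i+1] × [j, j+1]` (its center is in position
`(i, j)`, counted from `0`, of the array of edge centers) has weight `A (i mod k) (j mod l)`. -/
def patternWeight {k l : ℕ} [NeZero k] [NeZero l] (A : Matrix (Fin k) (Fin l) ℝ) (n : ℕ) :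
    Sym2 (AztecVertex n) → ℝ :=
  Sym2.lift ⟨fun u v => periodicArray A (min u.row v.row) (min u.col v.col), fun u v => by
    simp only [min_comm u.row, min_comm u.col]⟩

/-- `M(AD_n(wt_A))`: the matching generating function of the Aztec diamond graph of order `n`
with weight pattern `A`. -/
noncomputable def aztecGenFun {k l : ℕ} [NeZero k] [NeZero l] (A : Matrix (Fin k) (Fin l) ℝ)
    (n : ℕ) : ℝ :=
  matchingGenFun (aztecDiamond n) (patternWeight A n)

/-- The `4 × 4` weight pattern `B`. -/
def patternB (a b c d : ℝ) : Matrix (Fin 4) (Fin 4) ℝ :=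
  !![a, b, c, d;
     b, a, d, c;
     d, c, b, a;
     c, d, a, b]

/-! The proof reduces the order by complementation. Cut the array of edges into `2 × 2` blocks. Each
block is a 4-cycle (a cell) on its north, south, west and east vertices; an interior vertex lies in
two cells, a boundary vertex in one. A perfect matching selects, in each cell, the set of vertices
matched inside that cell. Complementing all these sets keeps every interior vertex covered exactly
once and uncovers the boundary. In one cell with opposite edges `x, t` and `y, z`, the matching
weight of a vertex set is `xt + yz` times that of the complementary set, once opposite edges are
exchanged and all weights divided by `xt + yz` (`cellWeight_flip`). Deleting the uncovered boundary
leaves an Aztec diamond of order one less, whence the recurrence `coverGenFun_succ`.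

For the pattern `B` the cell factors alternate between `u = a² + b²` and `v = c² + d²`. One
complementation gives a pattern with constant cell factor `D = ab/u² + cd/v²`, and a second one
returns to `B` with rescaled parameters (`coverGenFun_patternB_add_two`). With `Q = ab + cd` one has
`P = D u² v²`, and the new parameters have `P' = Q / (u² v² D⁶)` and `Q' = 1 / D`. So, up to powers
of `u, v, D`, two steps exchange `P` with `Q` inverting one of them, which is why the formula
depends on the order mod 4. The rest is induction and comparison of exponents. -/

/-! ### Cells, covers and assignments -/

/-- The indicator of the position `(i, j)` in a set of array positions. -/
def occ (S : Finset (ℕ × ℕ)) (i j : ℕ) : ℕ := if (i, j) ∈ S then 1 else 0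

/-- Number of chosen edges of the cell `(I, J)` at its north vertex. -/
def northDeg (S : Finset (ℕ × ℕ)) (I J : ℕ) : ℕ :=
  occ S (2 * I + 1) (2 * J + 1) + occ S (2 * I + 1) (2 * J + 2)

/-- Number of chosen edges of the cell `(I, J)` at its south vertex. -/
def southDeg (S : Finset (ℕ × ℕ)) (I J : ℕ) : ℕ :=
  occ S (2 * I + 2) (2 * J + 1) + occ S (2 * I + 2) (2 * J + 2)

/-- Number of chosen edges of the cell `(I, J)` at its west vertex. -/
def westDeg (S : Finset (ℕ × ℕ)) (I J : ℕ) : ℕ :=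
  occ S (2 * I + 1) (2 * J + 1) + occ S (2 * I + 2) (2 * J + 1)

/-- Number of chosen edges of the cell `(I, J)` at its east vertex. -/
def eastDeg (S : Finset (ℕ × ℕ)) (I J : ℕ) : ℕ :=
  occ S (2 * I + 1) (2 * J + 2) + occ S (2 * I + 2) (2 * J + 2)

/-- The edges of the cell `(I, J)`, as positions of the array of edge centers
(numbered from `1`). -/
def cellBlock (I J : ℕ) : Finset (ℕ × ℕ) :=
  {(2 * I + 1, 2 * J + 1), (2 * I + 1, 2 * J + 2), (2 * I + 2, 2 * J + 1),
    (2 * I + 2, 2 * J + 2)}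

/-- The array of edge centers of the Aztec diamond of order `n`, numbered from `1`. -/
def edgeArray (n : ℕ) : Finset (ℕ × ℕ) := Finset.Icc 1 (2 * n) ×ˢ Finset.Icc 1 (2 * n)

/-- Every interior vertex has degree one and every boundary vertex has degree `b` in `S`. -/
def IsCellCover (b : Bool) (n : ℕ) (S : Finset (ℕ × ℕ)) : Prop :=
  (∀ I I' J : Fin n, I'.val = I.val + 1 → northDeg S I' J + southDeg S I J = 1) ∧
  (∀ I J J' : Fin n, J'.val = J.val + 1 → westDeg S I J' + eastDeg S I J = 1) ∧
  (∀ I J : Fin n, I.val = 0 → northDeg S I J = b.toNat) ∧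
  (∀ I J : Fin n, I.val + 1 = n → southDeg S I J = b.toNat) ∧
  (∀ I J : Fin n, J.val = 0 → westDeg S I J = b.toNat) ∧
  (∀ I J : Fin n, J.val + 1 = n → eastDeg S I J = b.toNat)

/-- `T` tells for each cell which of its north, south, west, east vertices are covered by edges
of the cell; interior vertices are covered from exactly one side, boundary vertices are covered
according to `b`. -/
def IsAssignment (b : Bool) {n : ℕ} (T : Fin n × Fin n → Fin 4 → Bool) : Prop :=
  (∀ I I' J : Fin n, I'.val = I.val + 1 → T (I', J) 0 = !T (I, J) 1) ∧
  (∀ I J J' : Fin n, J'.val = J.val + 1 → T (I, J') 2 = !T (I, J) 3) ∧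
  (∀ I J : Fin n, I.val = 0 → T (I, J) 0 = b) ∧
  (∀ I J : Fin n, I.val + 1 = n → T (I, J) 1 = b) ∧
  (∀ I J : Fin n, J.val = 0 → T (I, J) 2 = b) ∧
  (∀ I J : Fin n, J.val + 1 = n → T (I, J) 3 = b)

/-- The edges of `S` in the cell `(I, J)` form a perfect matching of the vertices selected
by `τ`. -/
def CellMatch (S : Finset (ℕ × ℕ)) (I J : ℕ) (τ : Fin 4 → Bool) : Prop :=
  northDeg S I J = (τ 0).toNat ∧ southDeg S I J = (τ 1).toNat ∧
  westDeg S I J = (τ 2).toNat ∧ eastDeg S I J = (τ 3).toNat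

open scoped Classical in
/-- The matching generating function of the vertices of a cell selected by `τ`. -/
noncomputable def cellWeight (w : ℕ × ℕ → ℝ) (I J : ℕ) (τ : Fin 4 → Bool) : ℝ :=
  ∑ A ∈ (cellBlock I J).powerset, if CellMatch A I J τ then ∏ e ∈ A, w e else 0

open scoped Classical in
/-- The generating function of the sets of edges with degree one at each interior vertex and
degree `b` at each boundary vertex. -/
noncomputable def coverGenFun (b : Bool) (n : ℕ) (w : ℕ × ℕ → ℝ) : ℝ :=
  ∑ S ∈ (edgeArray n).powerset with IsCellCover b n S, ∏ e ∈ S, w e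

/-! ### Factorization of the generating function over cells -/

/-- This is distributivity: a subset of a disjoint union is a free choice of a subset of each block.
-/
lemma sum_powerset_biUnion {ι α : Type*} [Fintype ι] [DecidableEq ι] [DecidableEq α]
    (B : ι → Finset α) (hB : ∀ i j, i ≠ j → Disjoint (B i) (B j)) (g : ι → Finset α → ℝ) :
    ∑ S ∈ (Finset.univ.biUnion B).powerset, ∏ i, g i (S ∩ B i) =
      ∏ i, ∑ A ∈ (B i).powerset, g i A := by
  rw [Finset.prod_univ_sum]
  refine Finset.sum_bij' (fun S _ i => S ∩ B i) (fun p _ => Finset.univ.biUnion p) ?_ ?_ ?_ ?_ ?_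
  · intro S _
    simp [Fintype.mem_piFinset, Finset.inter_subset_right]
  · intro p hp
    simp only [Fintype.mem_piFinset, Finset.mem_powerset] at hp ⊢
    exact Finset.biUnion_mono fun i _ => hp i
  · intro S hS
    rw [Finset.mem_powerset] at hS
    rw [← Finset.inter_biUnion, Finset.inter_eq_left.2 hS]
  · intro p hp
    simp only [Fintype.mem_piFinset, Finset.mem_powerset] at hp
    funext i
    ext x
    simp only [Finset.mem_inter, Finset.mem_biUnion, Finset.mem_univ, true_and]
    constructor
    · rintro ⟨⟨j, hj⟩, hi⟩
      by_cases h : j = i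
      · exact h ▸ hj
      · exact absurd hi (Finset.disjoint_left.1 (hB j i h) (hp j hj))
    · exact fun h => ⟨⟨i, h⟩, hp i h⟩
  · intro S _
    rfl

lemma mem_cellBlock {I J i j : ℕ} :
    (i, j) ∈ cellBlock I J ↔ (i = 2 * I + 1 ∨ i = 2 * I + 2) ∧ (j = 2 * J + 1 ∨ j = 2 * J + 2) := by
  simp only [cellBlock, Finset.mem_insert, Finset.mem_singleton, Prod.mk.injEq]
  tauto

lemma edgeArray_eq_biUnion (n : ℕ) :
    edgeArray n = Finset.univ.biUnion (fun c : Fin n × Fin n => cellBlock c.1 c.2) := by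
  ext ⟨i, j⟩
  simp only [edgeArray, Finset.mem_product, Finset.mem_Icc, Finset.mem_biUnion, Finset.mem_univ,
    true_and, mem_cellBlock]
  constructor
  · rintro ⟨⟨h1, h2⟩, h3, h4⟩
    refine ⟨(⟨(i - 1) / 2, by omega⟩, ⟨(j - 1) / 2, by omega⟩), ?_⟩
    simp only
    omega
  · rintro ⟨⟨⟨I, hI⟩, ⟨J, hJ⟩⟩, h⟩
    simp only at h
    omega

lemma disjoint_cellBlock {n : ℕ} (c c' : Fin n × Fin n) (h : c ≠ c') :
    Disjoint (cellBlock c.1 c.2) (cellBlock c'.1 c'.2) := by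
  rw [Finset.disjoint_left]
  rintro ⟨i, j⟩ h1 h2
  rw [mem_cellBlock] at h1 h2
  apply h
  ext <;> omega

lemma occ_inter_cellBlock {S : Finset (ℕ × ℕ)} {I J i j : ℕ} (h : (i, j) ∈ cellBlock I J) :
    occ (S ∩ cellBlock I J) i j = occ S i j := by
  simp [occ, h]

lemma cellMatch_inter {S : Finset (ℕ × ℕ)} {I J : ℕ} {τ : Fin 4 → Bool} :
    CellMatch (S ∩ cellBlock I J) I J τ ↔ CellMatch S I J τ := by
  unfold CellMatch northDeg southDeg westDeg eastDeg
  rw [occ_inter_cellBlock (by simp [mem_cellBlock]), occ_inter_cellBlock (by simp [mem_cellBlock]),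
    occ_inter_cellBlock (by simp [mem_cellBlock]), occ_inter_cellBlock (by simp [mem_cellBlock])]

open scoped Classical in
lemma prod_cellWeight {n : ℕ} (w : ℕ × ℕ → ℝ) (T : Fin n × Fin n → Fin 4 → Bool) :
    ∏ c : Fin n × Fin n, cellWeight w c.1 c.2 (T c) =
      ∑ S ∈ (edgeArray n).powerset,
        if ∀ c : Fin n × Fin n, CellMatch S c.1 c.2 (T c) then ∏ e ∈ S, w e else 0 := by
  unfold cellWeight
  rw [← sum_powerset_biUnion _ disjoint_cellBlock
    (fun c A => if CellMatch A c.1 c.2 (T c) then ∏ e ∈ A, w e else 0), ← edgeArray_eq_biUnion]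
  refine Finset.sum_congr rfl fun S hS => ?_
  simp only [cellMatch_inter]
  rw [Finset.prod_ite_zero]
  simp only [Finset.mem_univ, true_implies]
  congr 1
  rw [← Finset.prod_biUnion, ← Finset.inter_biUnion, ← edgeArray_eq_biUnion,
    Finset.inter_eq_left.2 (Finset.mem_powerset.1 hS)]
  intro c _ c' _ h
  exact (disjoint_cellBlock c c' h).mono Finset.inter_subset_right Finset.inter_subset_right

/-- In a cover every vertex receives 0 or 1 edges from each cell containing it, so the degrees
inside the cells can be read as Booleans. The degree equation at an interior vertex then says that
the two Booleans are opposite. -/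
lemma exists_assignment_iff {b : Bool} {n : ℕ} {S : Finset (ℕ × ℕ)} :
    IsCellCover b n S ↔ ∃ T : Fin n × Fin n → Fin 4 → Bool, IsAssignment b T ∧
      ∀ c : Fin n × Fin n, CellMatch S c.1 c.2 (T c) := by
  constructor
  · rintro ⟨h1, h2, h3, h4, h5, h6⟩
    have hb : b.toNat ≤ 1 := Bool.toNat_le b
    have hN : ∀ I J : Fin n, northDeg S I J ≤ 1 := by
      intro I J
      by_cases h : I.val = 0
      · rw [h3 I J h]; exact hb
      · have := h1 ⟨I.val - 1, by omega⟩ I J (by simp only; omega)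
        omega
    have hS : ∀ I J : Fin n, southDeg S I J ≤ 1 := by
      intro I J
      by_cases h : I.val + 1 = n
      · rw [h4 I J h]; exact hb
      · have := h1 I ⟨I.val + 1, by omega⟩ J rfl
        omega
    have hW : ∀ I J : Fin n, westDeg S I J ≤ 1 := by
      intro I J
      by_cases h : J.val = 0
      · rw [h5 I J h]; exact hb
      · have := h2 I ⟨J.val - 1, by omega⟩ J (by simp only; omega)
        omega
    have hE : ∀ I J : Fin n, eastDeg S I J ≤ 1 := by
      intro I J
      by_cases h : J.val + 1 = n
      · rw [h6 I J h]; exact hb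
      · have := h2 I J ⟨J.val + 1, by omega⟩ rfl
        omega
    have key : ∀ x y : ℕ, x + y = 1 → decide (x = 1) = !decide (y = 1) := by
      intro x y h
      have : x ≤ 1 := by omega
      interval_cases x
      · simp [show y = 1 by omega]
      · simp [show y = 0 by omega]
    have key2 : ∀ x : ℕ, x ≤ 1 → x = (decide (x = 1)).toNat := by
      intro x h
      interval_cases x <;> rfl
    have key3 : ∀ x : ℕ, x = b.toNat → decide (x = 1) = b := by
      intro x h
      subst h
      cases b <;> rfl
    refine ⟨fun c => ![decide (northDeg S c.1 c.2 = 1), decide (southDeg S c.1 c.2 = 1),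
      decide (westDeg S c.1 c.2 = 1), decide (eastDeg S c.1 c.2 = 1)],
      ⟨fun I I' J h => key _ _ (h1 I I' J h), fun I J J' h => key _ _ (h2 I J J' h),
        fun I J h => key3 _ (h3 I J h), fun I J h => key3 _ (h4 I J h),
        fun I J h => key3 _ (h5 I J h), fun I J h => key3 _ (h6 I J h)⟩,
      fun c => ⟨key2 _ (hN _ _), key2 _ (hS _ _), key2 _ (hW _ _), key2 _ (hE _ _)⟩⟩
  · rintro ⟨T, ⟨h1, h2, h3, h4, h5, h6⟩, h⟩
    have key : ∀ x : Bool, (!x).toNat + x.toNat = 1 := by decide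
    refine ⟨?_, ?_, ?_, ?_, ?_, ?_⟩
    · intro I I' J e
      rw [(h (I', J)).1, (h (I, J)).2.1, h1 I I' J e, key]
    · intro I J J' e
      rw [(h (I, J')).2.2.1, (h (I, J)).2.2.2, h2 I J J' e, key]
    · intro I J e
      rw [(h (I, J)).1, h3 I J e]
    · intro I J e
      rw [(h (I, J)).2.1, h4 I J e]
    · intro I J e
      rw [(h (I, J)).2.2.1, h5 I J e]
    · intro I J e
      rw [(h (I, J)).2.2.2, h6 I J e]

lemma CellMatch.unique {S : Finset (ℕ × ℕ)} {I J : ℕ} {τ τ' : Fin 4 → Bool}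
    (h : CellMatch S I J τ) (h' : CellMatch S I J τ') : τ = τ' := by
  have key : ∀ x y : Bool, x.toNat = y.toNat → x = y := by decide
  funext k
  fin_cases k
  · exact key _ _ (h.1.symm.trans h'.1)
  · exact key _ _ (h.2.1.symm.trans h'.2.1)
  · exact key _ _ (h.2.2.1.symm.trans h'.2.2.1)
  · exact key _ _ (h.2.2.2.symm.trans h'.2.2.2)

-- A cover determines its assignment (`CellMatch.unique`), so after exchanging the sums each cover
-- is counted exactly once.
open scoped Classical in
lemma coverGenFun_eq_sum_assignment (b : Bool) (n : ℕ) (w : ℕ × ℕ → ℝ) :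
    coverGenFun b n w = ∑ T : Fin n × Fin n → Fin 4 → Bool with IsAssignment b T,
      ∏ c : Fin n × Fin n, cellWeight w c.1 c.2 (T c) := by
  simp only [prod_cellWeight]
  rw [Finset.sum_comm, coverGenFun, Finset.sum_filter]
  refine Finset.sum_congr rfl fun S _ => ?_
  rw [← Finset.sum_filter, Finset.filter_filter]
  split_ifs with h
  · obtain ⟨T, hT, hm⟩ := exists_assignment_iff.1 h
    rw [Finset.sum_eq_single T]
    · intro T' hT' hne
      simp only [Finset.mem_filter] at hT'
      exact absurd (funext fun c => (hT'.2.2 c).unique (hm c)) hne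
    · intro hn
      exact absurd (Finset.mem_filter.2 ⟨Finset.mem_univ _, hT, hm⟩) hn
  · rw [Finset.sum_eq_zero]
    intro T hT
    simp only [Finset.mem_filter] at hT
    exact absurd (exists_assignment_iff.2 ⟨T, hT.2⟩) h

/-! ### Complementation -/

/-- The weight of the pair of matchings of a cell. -/
def cellFactor (w : ℕ × ℕ → ℝ) (I J : ℕ) : ℝ :=
  w (2 * I + 1, 2 * J + 1) * w (2 * I + 2, 2 * J + 2) +
    w (2 * I + 1, 2 * J + 2) * w (2 * I + 2, 2 * J + 1)

/-- The other index in the pair `{2 * I + 1, 2 * I + 2}`. -/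
def mate (i : ℕ) : ℕ := if i % 2 = 1 then i + 1 else i - 1

/-- The complementary weight: opposite edges of each cell are exchanged and divided by the cell
factor. -/
noncomputable def flipWeight (w : ℕ × ℕ → ℝ) (e : ℕ × ℕ) : ℝ :=
  w (mate e.1, mate e.2) / cellFactor w ((e.1 - 1) / 2) ((e.2 - 1) / 2)

lemma mate_odd (I : ℕ) : mate (2 * I + 1) = 2 * I + 2 := by
  unfold mate; split_ifs <;> omega

lemma mate_even (I : ℕ) : mate (2 * I + 2) = 2 * I + 1 := by
  unfold mate; split_ifs <;> omega

lemma cellWeight_eq (w : ℕ × ℕ → ℝ) (I J : ℕ) (τ : Fin 4 → Bool) :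
    cellWeight w I J τ = ∑ x : Bool, ∑ y : Bool, ∑ z : Bool, ∑ t : Bool,
      if x.toNat + y.toNat = (τ 0).toNat ∧ z.toNat + t.toNat = (τ 1).toNat ∧
        x.toNat + z.toNat = (τ 2).toNat ∧ y.toNat + t.toNat = (τ 3).toNat then
      (if x then w (2 * I + 1, 2 * J + 1) else 1) * (if y then w (2 * I + 1, 2 * J + 2) else 1) *
      (if z then w (2 * I + 2, 2 * J + 1) else 1) * (if t then w (2 * I + 2, 2 * J + 2) else 1)
      else 0 := by
  unfold cellWeight cellBlock
  have h1 : (2 * I + 1, 2 * J + 1) ∉ ({(2 * I + 1, 2 * J + 2), (2 * I + 2, 2 * J + 1),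
    (2 * I + 2, 2 * J + 2)} : Finset (ℕ × ℕ)) := by simp
  have h2 : (2 * I + 1, 2 * J + 2) ∉ ({(2 * I + 2, 2 * J + 1),
    (2 * I + 2, 2 * J + 2)} : Finset (ℕ × ℕ)) := by simp
  have h3 : (2 * I + 2, 2 * J + 1) ∉ ({(2 * I + 2, 2 * J + 2)} : Finset (ℕ × ℕ)) := by simp
  have h4 : (2 * I + 2, 2 * J + 2) ∉ (∅ : Finset (ℕ × ℕ)) := by simp
  -- Writing the last singleton as an insertion into `∅` lets `Finset.sum_powerset_insert` peel off
  -- all four edges.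
  rw [← insert_empty_eq (2 * I + 2, 2 * J + 2)] at *
  simp only [Finset.sum_powerset_insert h1, Finset.sum_powerset_insert h2,
    Finset.sum_powerset_insert h3, Finset.sum_powerset_insert h4, Finset.powerset_empty,
    Finset.sum_singleton, Fintype.sum_bool]
  simp [CellMatch, northDeg, southDeg, westDeg, eastDeg, occ]
  ring_nf

/-- The full vertex set has weight equal to the cell factor `F` and the empty set has weight 1.
After the flip the full set has weight `F / F² = 1 / F`. Two adjacent vertices are matched by one
edge, and the other two by the opposite edge, whose flipped weight is the original one over `F`. All
other vertex sets have weight 0, as do their complements. -/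
lemma cellWeight_flip (w : ℕ × ℕ → ℝ) (I J : ℕ) (h : cellFactor w I J ≠ 0) (τ : Fin 4 → Bool) :
    cellWeight w I J τ = cellFactor w I J * cellWeight (flipWeight w) I J (fun k => !τ k) := by
  have h1 : flipWeight w (2 * I + 1, 2 * J + 1) = w (2 * I + 2, 2 * J + 2) / cellFactor w I J := by
    simp only [flipWeight, mate_odd]; congr 2 <;> omega
  have h2 : flipWeight w (2 * I + 1, 2 * J + 2) = w (2 * I + 2, 2 * J + 1) / cellFactor w I J := by
    simp only [flipWeight, mate_odd, mate_even]; congr 2 <;> omega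
  have h3 : flipWeight w (2 * I + 2, 2 * J + 1) = w (2 * I + 1, 2 * J + 2) / cellFactor w I J := by
    simp only [flipWeight, mate_odd, mate_even]; congr 2 <;> omega
  have h4 : flipWeight w (2 * I + 2, 2 * J + 2) = w (2 * I + 1, 2 * J + 1) / cellFactor w I J := by
    simp only [flipWeight, mate_even]; congr 2 <;> omega
  rw [cellWeight_eq, cellWeight_eq, h1, h2, h3, h4]
  have hF : cellFactor w I J = w (2 * I + 1, 2 * J + 1) * w (2 * I + 2, 2 * J + 2) +
    w (2 * I + 1, 2 * J + 2) * w (2 * I + 2, 2 * J + 1) := rfl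
  generalize cellFactor w I J = F at *
  generalize w (2 * I + 1, 2 * J + 1) = x at *
  generalize w (2 * I + 1, 2 * J + 2) = y at *
  generalize w (2 * I + 2, 2 * J + 1) = z at *
  generalize w (2 * I + 2, 2 * J + 2) = t at *
  generalize τ 0 = p
  generalize τ 1 = q
  generalize τ 2 = r
  generalize τ 3 = s
  simp only [Fintype.sum_bool]
  -- The sixteen vertex sets of the cell.
  cases p <;> cases q <;> cases r <;> cases s <;> simp <;> field_simp <;> linarith

lemma isAssignment_not {b : Bool} {n : ℕ} {T : Fin n × Fin n → Fin 4 → Bool} :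
    IsAssignment (!b) (fun c k => !T c k) ↔ IsAssignment b T := by
  simp [IsAssignment]

theorem coverGenFun_complement (b : Bool) (n : ℕ) (w : ℕ × ℕ → ℝ)
    (h : ∀ I J : Fin n, cellFactor w I J ≠ 0) :
    coverGenFun b n w =
      (∏ c : Fin n × Fin n, cellFactor w c.1 c.2) * coverGenFun (!b) n (flipWeight w) := by
  rw [coverGenFun_eq_sum_assignment, coverGenFun_eq_sum_assignment, Finset.mul_sum]
  refine Finset.sum_bij' (fun T _ c k => !T c k) (fun T _ c k => !T c k) ?_ ?_ ?_ ?_ ?_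
  · intro T hT
    simpa [isAssignment_not] using hT
  · intro T hT
    have := @isAssignment_not (!b) n T
    simp only [Bool.not_not] at this
    simpa [this] using hT
  · intro T _; simp
  · intro T _; simp
  · intro T _
    rw [← Finset.prod_mul_distrib]
    exact Finset.prod_congr rfl fun c _ => cellWeight_flip w _ _ (h _ _) _

/-! ### Removing the uncovered boundary -/

/-- The number of edges in `S` at the vertex `(p, q)`. -/
def vertexDeg (S : Finset (ℕ × ℕ)) (p q : ℕ) : ℕ :=
  occ S p q + occ S p (q + 1) + occ S (p + 1) q + occ S (p + 1) (q + 1)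

lemma occ_eq_zero {S : Finset (ℕ × ℕ)} {n i j : ℕ} (hS : S ⊆ edgeArray n)
    (h : i = 0 ∨ j = 0 ∨ 2 * n < i ∨ 2 * n < j) : occ S i j = 0 := by
  unfold occ
  rw [if_neg]
  intro hm
  have := hS hm
  simp only [edgeArray, Finset.mem_product, Finset.mem_Icc] at this
  omega

/-- Vertices with `p` even are the north and south vertices of cells, those with `p` odd the west
and east ones. On the boundary, the edges that would stick out of the array contribute 0. -/
lemma isCellCover_true_iff {n : ℕ} {S : Finset (ℕ × ℕ)} (hS : S ⊆ edgeArray n) :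
    IsCellCover true n S ↔
      ∀ p q : ℕ, p ≤ 2 * n → q ≤ 2 * n → Odd (p + q) → vertexDeg S p q = 1 := by
  constructor
  · rintro ⟨h1, h2, h3, h4, h5, h6⟩ p q hp hq hpq
    simp only [northDeg, southDeg, westDeg, eastDeg, Bool.toNat_true] at h1 h2 h3 h4 h5 h6
    unfold vertexDeg
    rcases Nat.even_or_odd' p with ⟨I, rfl | rfl⟩ <;> rcases Nat.even_or_odd' q with ⟨J, rfl | rfl⟩
    · exact absurd hpq (by rw [Nat.not_odd_iff]; omega)
    · rcases I with _ | I
      · rw [occ_eq_zero hS (i := 2 * 0) (by simp), occ_eq_zero hS (i := 2 * 0) (by simp)]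
        have := h3 ⟨0, by omega⟩ ⟨J, by omega⟩ rfl
        simpa using this
      · by_cases hI : I + 1 = n
        · rw [occ_eq_zero hS (i := 2 * (I + 1) + 1) (by omega),
            occ_eq_zero hS (i := 2 * (I + 1) + 1) (by omega)]
          exact h4 ⟨I, by omega⟩ ⟨J, by omega⟩ hI
        · have := h1 ⟨I, by omega⟩ ⟨I + 1, by omega⟩ ⟨J, by omega⟩ rfl
          simp only [mul_add, mul_one, add_assoc, Nat.reduceAdd] at this ⊢
          omega
    · rcases J with _ | J
      · rw [occ_eq_zero hS (j := 2 * 0) (by simp), occ_eq_zero hS (j := 2 * 0) (by simp)]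
        have := h5 ⟨I, by omega⟩ ⟨0, by omega⟩ rfl
        simpa using this
      · by_cases hJ : J + 1 = n
        · rw [occ_eq_zero hS (j := 2 * (J + 1) + 1) (by omega),
            occ_eq_zero hS (j := 2 * (J + 1) + 1) (by omega)]
          exact h6 ⟨I, by omega⟩ ⟨J, by omega⟩ hJ
        · have := h2 ⟨I, by omega⟩ ⟨J, by omega⟩ ⟨J + 1, by omega⟩ rfl
          simp only [mul_add, mul_one, add_assoc, Nat.reduceAdd] at this ⊢
          omega
    · exact absurd hpq (by rw [Nat.not_odd_iff]; omega)
  · intro h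
    unfold vertexDeg at h
    have hv : ∀ I J : ℕ, 2 * I ≤ 2 * n → 2 * J + 1 ≤ 2 * n → occ S (2 * I) (2 * J + 1) +
        occ S (2 * I) (2 * J + 2) + occ S (2 * I + 1) (2 * J + 1) +
        occ S (2 * I + 1) (2 * J + 2) = 1 :=
      fun I J h1 h2 => h _ _ h1 h2 (by rw [Nat.odd_iff]; omega)
    have hh : ∀ I J : ℕ, 2 * I + 1 ≤ 2 * n → 2 * J ≤ 2 * n → occ S (2 * I + 1) (2 * J) +
        occ S (2 * I + 1) (2 * J + 1) + occ S (2 * I + 2) (2 * J) +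
        occ S (2 * I + 2) (2 * J + 1) = 1 :=
      fun I J h1 h2 => h _ _ h1 h2 (by rw [Nat.odd_iff]; omega)
    unfold IsCellCover northDeg southDeg westDeg eastDeg
    refine ⟨?_, ?_, ?_, ?_, ?_, ?_⟩
    · intro I I' J e
      have := hv I' J (by omega) (by omega)
      rw [e] at this ⊢
      simp only [mul_add, mul_one, add_assoc, Nat.reduceAdd] at this ⊢
      omega
    · intro I J J' e
      have := hh I J' (by omega) (by omega)
      rw [e] at this ⊢
      simp only [mul_add, mul_one, add_assoc, Nat.reduceAdd] at this ⊢
      omega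
    · intro I J e
      have := hv I J (by omega) (by omega)
      rw [occ_eq_zero hS (i := 2 * I) (by omega), occ_eq_zero hS (i := 2 * I) (by omega)] at this
      simp only [Bool.toNat_true]
      omega
    · intro I J e
      have := hv (I + 1) J (by omega) (by omega)
      rw [occ_eq_zero hS (i := 2 * (I + 1) + 1) (by omega),
        occ_eq_zero hS (i := 2 * (I + 1) + 1) (by omega)] at this
      simpa [mul_add] using this
    · intro I J e
      have := hh I J (by omega) (by omega)
      rw [occ_eq_zero hS (j := 2 * J) (by omega), occ_eq_zero hS (j := 2 * J) (by omega)] at this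
      simp only [Bool.toNat_true]
      omega
    · intro I J e
      have := hh I (J + 1) (by omega) (by omega)
      rw [occ_eq_zero hS (j := 2 * (J + 1) + 1) (by omega),
        occ_eq_zero hS (j := 2 * (J + 1) + 1) (by omega)] at this
      simp only [Bool.toNat_true]
      simp only [mul_add] at this
      omega

/-- The translation by `(1, 1)` of array positions. -/
def diagShift : ℕ × ℕ ↪ ℕ × ℕ :=
  ⟨fun e => (e.1 + 1, e.2 + 1), fun e f h => by
    simp only [Prod.mk.injEq, add_left_inj] at h
    exact Prod.ext h.1 h.2⟩

lemma diagShift_apply (e : ℕ × ℕ) : diagShift e = (e.1 + 1, e.2 + 1) := rfl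

lemma occ_map_diagShift (S : Finset (ℕ × ℕ)) (i j : ℕ) :
    occ (S.map diagShift) (i + 1) (j + 1) = occ S i j := by
  have : (i + 1, j + 1) = diagShift (i, j) := rfl
  simp only [occ, this, Finset.mem_map']

lemma map_diagShift_subset {n : ℕ} {S : Finset (ℕ × ℕ)} (hS : S ⊆ edgeArray n) :
    S.map diagShift ⊆ edgeArray (n + 1) := by
  intro e he
  obtain ⟨f, hf, rfl⟩ := Finset.mem_map.1 he
  have := hS hf
  simp only [edgeArray, Finset.mem_product, Finset.mem_Icc, diagShift_apply] at this ⊢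
  omega

/-- The interior vertices of order `n + 1` are exactly the shifted vertices of order `n`. The shift
changes both parities, so vertices joining vertically neighbouring cells become those with `p` odd.
The boundary conditions hold automatically, since a shifted set avoids the outer ring of the array.
-/
lemma isCellCover_false_map_iff {n : ℕ} {S : Finset (ℕ × ℕ)} (hS : S ⊆ edgeArray n) :
    IsCellCover false (n + 1) (S.map diagShift) ↔ IsCellCover true n S := by
  rw [isCellCover_true_iff hS]
  unfold IsCellCover northDeg southDeg westDeg eastDeg
  have e : ∀ i j : ℕ, occ (S.map diagShift) (i + 2) (j + 2) = occ S (i + 1) (j + 1) :=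
    fun i j => occ_map_diagShift S (i + 1) (j + 1)
  have e' : ∀ i j : ℕ, occ (S.map diagShift) (i + 1) (j + 2) = occ S i (j + 1) :=
    fun i j => occ_map_diagShift S i (j + 1)
  have e'' : ∀ i j : ℕ, occ (S.map diagShift) (i + 2) (j + 1) = occ S (i + 1) j :=
    fun i j => occ_map_diagShift S (i + 1) j
  simp only [occ_map_diagShift, e, e', e'', Bool.toNat_false]
  constructor
  · rintro ⟨h1, h2, -⟩ p q hp hq hpq
    unfold vertexDeg
    rcases Nat.even_or_odd' p with ⟨I, rfl | rfl⟩ <;> rcases Nat.even_or_odd' q with ⟨J, rfl | rfl⟩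
    · exact absurd hpq (by rw [Nat.not_odd_iff]; omega)
    · have := h2 ⟨I, by omega⟩ ⟨J, by omega⟩ ⟨J + 1, by omega⟩ rfl
      simp only [mul_add, mul_one, add_assoc, Nat.reduceAdd] at this ⊢
      omega
    · have := h1 ⟨I, by omega⟩ ⟨I + 1, by omega⟩ ⟨J, by omega⟩ rfl
      simp only [mul_add, mul_one, add_assoc, Nat.reduceAdd] at this ⊢
      omega
    · exact absurd hpq (by rw [Nat.not_odd_iff]; omega)
  · intro h
    unfold vertexDeg at h
    refine ⟨?_, ?_, ?_, ?_, ?_, ?_⟩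
    · intro I I' J e
      have := h (2 * I + 1) (2 * J) (by omega) (by omega) (by rw [Nat.odd_iff]; omega)
      rw [e]
      simp only [mul_add, mul_one, add_assoc, Nat.reduceAdd] at this ⊢
      omega
    · intro I J J' e
      have := h (2 * I) (2 * J + 1) (by omega) (by omega) (by rw [Nat.odd_iff]; omega)
      rw [e]
      simp only [mul_add, mul_one, add_assoc, Nat.reduceAdd] at this ⊢
      omega
    all_goals
      intro I J e
      rw [occ_eq_zero hS (by omega), occ_eq_zero hS (by omega)]

lemma eq_zero_of_pairs {f : ℕ → ℕ} {m : ℕ}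
    (h : ∀ I < m, f (2 * I + 1) = 0 ∧ f (2 * I + 2) = 0) {i : ℕ} (h1 : 1 ≤ i) (h2 : i ≤ 2 * m) :
    f i = 0 := by
  rcases Nat.even_or_odd' i with ⟨I, rfl | rfl⟩
  · obtain ⟨I, rfl⟩ := Nat.exists_eq_succ_of_ne_zero (show I ≠ 0 by omega)
    exact (h I (by omega)).2
  · exact (h I (by omega)).1

/-- The outermost rows and columns consist of edges at boundary vertices, so degree 0 there empties
them. -/
lemma subset_map_diagShift {n : ℕ} {S : Finset (ℕ × ℕ)} (hS : S ⊆ edgeArray (n + 1))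
    (h : IsCellCover false (n + 1) S) : S ⊆ (edgeArray n).map diagShift := by
  rintro ⟨i, j⟩ he
  have hR := hS he
  simp only [edgeArray, Finset.mem_product, Finset.mem_Icc] at hR
  obtain ⟨-, -, h3, h4, h5, h6⟩ := h
  simp only [northDeg, southDeg, westDeg, eastDeg, Bool.toNat_false, Nat.add_eq_zero_iff] at h3 h4 h5 h6
  have ho : occ S i j ≠ 0 := by simp [occ, he]
  have hi1 : i ≠ 1 := by
    rintro rfl
    exact ho (eq_zero_of_pairs (f := fun j => occ S 1 j)
      (fun J hJ => h3 ⟨0, by omega⟩ ⟨J, hJ⟩ rfl) hR.2.1 hR.2.2)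
  have hj1 : j ≠ 1 := by
    rintro rfl
    exact ho (eq_zero_of_pairs (f := fun i => occ S i 1)
      (fun I hI => h5 ⟨I, hI⟩ ⟨0, by omega⟩ rfl) hR.1.1 hR.1.2)
  have hi2 : i ≠ 2 * (n + 1) := by
    rintro rfl
    exact ho (eq_zero_of_pairs (f := fun j => occ S (2 * (n + 1)) j)
      (fun J hJ => h4 ⟨n, by omega⟩ ⟨J, hJ⟩ rfl) hR.2.1 hR.2.2)
  have hj2 : j ≠ 2 * (n + 1) := by
    rintro rfl
    exact ho (eq_zero_of_pairs (f := fun i => occ S i (2 * (n + 1)))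
      (fun I hI => h6 ⟨I, hI⟩ ⟨n, by omega⟩ rfl) hR.1.1 hR.1.2)
  refine Finset.mem_map.2 ⟨(i - 1, j - 1), ?_, ?_⟩
  · simp only [edgeArray, Finset.mem_product, Finset.mem_Icc]
    omega
  · simp only [diagShift_apply, Prod.mk.injEq]
    omega

lemma coverGenFun_false_succ (n : ℕ) (w : ℕ × ℕ → ℝ) :
    coverGenFun false (n + 1) w = coverGenFun true n (fun e => w (e.1 + 1, e.2 + 1)) := by
  classical
  unfold coverGenFun
  symm
  refine Finset.sum_bij (fun S _ => S.map diagShift) ?_ ?_ ?_ ?_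
  · intro S hS
    simp only [Finset.mem_filter, Finset.mem_powerset] at hS ⊢
    exact ⟨map_diagShift_subset hS.1, (isCellCover_false_map_iff hS.1).2 hS.2⟩
  · intro S _ S' _ h
    exact Finset.map_injective _ h
  · intro S hS
    simp only [Finset.mem_filter, Finset.mem_powerset] at hS
    obtain ⟨S', hS', rfl⟩ := Finset.subset_map_iff.1 (subset_map_diagShift hS.1 hS.2)
    refine ⟨S', ?_, rfl⟩
    simp only [Finset.mem_filter, Finset.mem_powerset]
    exact ⟨hS', (isCellCover_false_map_iff hS').1 hS.2⟩
  · intro S _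
    rw [Finset.prod_map]
    rfl

/-- The weight on the Aztec diamond of order `n` produced from a weight on the Aztec diamond of
order `n + 1` by complementation. -/
noncomputable def stepWeight (w : ℕ × ℕ → ℝ) (e : ℕ × ℕ) : ℝ := flipWeight w (e.1 + 1, e.2 + 1)

theorem coverGenFun_succ (n : ℕ) (w : ℕ × ℕ → ℝ) (h : ∀ I J : ℕ, cellFactor w I J ≠ 0) :
    coverGenFun true (n + 1) w =
      (∏ c : Fin (n + 1) × Fin (n + 1), cellFactor w c.1 c.2) *
        coverGenFun true n (stepWeight w) := by
  rw [coverGenFun_complement true (n + 1) w fun I J => h I J, Bool.not_true,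
    coverGenFun_false_succ]
  rfl

lemma coverGenFun_zero (w : ℕ × ℕ → ℝ) : coverGenFun true 0 w = 1 := by
  classical
  have : edgeArray 0 = ∅ := by simp [edgeArray]
  rw [coverGenFun, this, Finset.powerset_empty, Finset.sum_filter, Finset.sum_singleton, if_pos]
  · simp
  · exact ⟨fun I => I.elim0, fun I => I.elim0, fun I => I.elim0, fun I => I.elim0,
      fun I => I.elim0, fun I => I.elim0⟩

/-! ### Perfect matchings as sets of array positions -/

/-- The position (numbered from `1`) of the center of an edge. -/
def edgePos (n : ℕ) : Sym2 (AztecVertex n) → ℕ × ℕ :=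
  Sym2.lift ⟨fun u v => (min u.row v.row + 1, min u.col v.col + 1), fun u v => by
    simp only [min_comm u.row, min_comm u.col]⟩

lemma AztecVertex.ext_iff' {n : ℕ} {u v : AztecVertex n} :
    u = v ↔ u.row = v.row ∧ u.col = v.col := by
  rw [Subtype.ext_iff, Prod.ext_iff, Fin.ext_iff, Fin.ext_iff]
  rfl

lemma AztecVertex.parity {n : ℕ} (v : AztecVertex n) : (v.row + v.col) % 2 = 1 :=
  Nat.odd_iff.1 v.2

lemma AztecVertex.row_le {n : ℕ} (v : AztecVertex n) : v.row ≤ 2 * n :=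
  Nat.lt_succ_iff.1 v.1.1.2

lemma AztecVertex.col_le {n : ℕ} (v : AztecVertex n) : v.col ≤ 2 * n :=
  Nat.lt_succ_iff.1 v.1.2.2

lemma mem_edge_iff {n : ℕ} {e : Sym2 (AztecVertex n)} (he : e ∈ (aztecDiamond n).edgeSet)
    (v : AztecVertex n) :
    v ∈ e ↔ ((edgePos n e).1 = v.row ∨ (edgePos n e).1 = v.row + 1) ∧
      ((edgePos n e).2 = v.col ∨ (edgePos n e).2 = v.col + 1) := by
  induction e using Sym2.ind with
  | _ x y =>
    rw [SimpleGraph.mem_edgeSet] at he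
    obtain ⟨h1, h2⟩ := he
    have hx := x.parity
    have hy := y.parity
    have hv := v.parity
    rw [Sym2.mem_iff, AztecVertex.ext_iff', AztecVertex.ext_iff']
    simp only [edgePos, Sym2.lift_mk]
    omega

lemma edgePos_injOn (n : ℕ) : Set.InjOn (edgePos n) (aztecDiamond n).edgeSet := by
  intro e he f hf h
  refine Sym2.ext fun v => ?_
  rw [mem_edge_iff he, mem_edge_iff hf, h]

lemma edgePos_mem {n : ℕ} {e : Sym2 (AztecVertex n)} (he : e ∈ (aztecDiamond n).edgeSet) :
    edgePos n e ∈ edgeArray n := by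
  induction e using Sym2.ind with
  | _ x y =>
    rw [SimpleGraph.mem_edgeSet] at he
    obtain ⟨h1, h2⟩ := he
    have hx := x.row_le
    have hy := y.row_le
    have hx' := x.col_le
    have hy' := y.col_le
    simp only [edgePos, Sym2.lift_mk, edgeArray, Finset.mem_product, Finset.mem_Icc]
    omega

lemma exists_edgePos {n : ℕ} {i j : ℕ} (h : (i, j) ∈ edgeArray n) :
    ∃ e ∈ (aztecDiamond n).edgeSet, edgePos n e = (i, j) := by
  simp only [edgeArray, Finset.mem_product, Finset.mem_Icc] at h
  rcases Nat.even_or_odd (i + j) with hij | hij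
  -- The parity of `i + j` decides which diagonal of the unit square has its endpoints among the
  -- vertices.
  · have := Nat.even_iff.1 hij
    refine ⟨s((⟨(⟨i - 1, by omega⟩, ⟨j, by omega⟩), Nat.odd_iff.2 (by simp only; omega)⟩ :
      AztecVertex n), (⟨(⟨i, by omega⟩, ⟨j - 1, by omega⟩), Nat.odd_iff.2 (by simp only; omega)⟩ :
      AztecVertex n)), ?_, ?_⟩
    · rw [SimpleGraph.mem_edgeSet]
      simp only [aztecDiamond, AztecVertex.row, AztecVertex.col]
      omega
    · simp only [edgePos, Sym2.lift_mk, AztecVertex.row, AztecVertex.col, Prod.mk.injEq]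
      omega
  · have := Nat.odd_iff.1 hij
    refine ⟨s((⟨(⟨i - 1, by omega⟩, ⟨j - 1, by omega⟩), Nat.odd_iff.2 (by simp only; omega)⟩ :
      AztecVertex n), (⟨(⟨i, by omega⟩, ⟨j, by omega⟩), Nat.odd_iff.2 (by simp only; omega)⟩ :
      AztecVertex n)), ?_, ?_⟩
    · rw [SimpleGraph.mem_edgeSet]
      simp only [aztecDiamond, AztecVertex.row, AztecVertex.col]
      omega
    · simp only [edgePos, Sym2.lift_mk, AztecVertex.row, AztecVertex.col, Prod.mk.injEq]
      omega

lemma vertexDeg_eq_card (S : Finset (ℕ × ℕ)) (p q : ℕ) :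
    vertexDeg S p q = (S.filter fun e => (e.1 = p ∨ e.1 = p + 1) ∧
      (e.2 = q ∨ e.2 = q + 1)).card := by
  have : (S.filter fun e => (e.1 = p ∨ e.1 = p + 1) ∧ (e.2 = q ∨ e.2 = q + 1)) =
      ({(p, q), (p, q + 1), (p + 1, q), (p + 1, q + 1)} : Finset (ℕ × ℕ)).filter (· ∈ S) := by
    ext ⟨i, j⟩
    simp only [Finset.mem_filter, Finset.mem_insert, Finset.mem_singleton, Prod.mk.injEq]
    tauto
  rw [this, Finset.card_filter, Finset.sum_insert (by simp), Finset.sum_insert (by simp),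
    Finset.sum_insert (by simp), Finset.sum_singleton]
  simp only [vertexDeg, occ]
  ring

lemma isPerfectMatchingEdges_iff {n : ℕ} {M : Finset (Sym2 (AztecVertex n))}
    (hM : ∀ e ∈ M, e ∈ (aztecDiamond n).edgeSet) :
    IsPerfectMatchingEdges (aztecDiamond n) M ↔ IsCellCover true n (M.image (edgePos n)) := by
  have hsub : M.image (edgePos n) ⊆ edgeArray n := by
    intro f hf
    obtain ⟨e, he, rfl⟩ := Finset.mem_image.1 hf
    exact edgePos_mem (hM e he)
  have key : ∀ v : AztecVertex n,
      (∃! e, e ∈ M ∧ v ∈ e) ↔ vertexDeg (M.image (edgePos n)) v.row v.col = 1 := by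
    intro v
    rw [vertexDeg_eq_card, Finset.filter_image, Finset.card_image_of_injOn,
      Finset.card_eq_one_iff_existsUnique]
    · simp only [Finset.mem_filter]
      refine existsUnique_congr fun e => and_congr_right fun he => mem_edge_iff (hM e he) v
    · intro e he f hf h
      exact edgePos_injOn n (hM e (Finset.mem_filter.1 he).1) (hM f (Finset.mem_filter.1 hf).1) h
  rw [isCellCover_true_iff hsub]
  constructor
  · rintro ⟨-, h⟩ p q hp hq hpq
    exact (key ⟨(⟨p, by omega⟩, ⟨q, by omega⟩), hpq⟩).1 (h _)
  · exact fun h => ⟨hM, fun v => (key v).2 (h _ _ v.row_le v.col_le v.2)⟩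

theorem aztecGenFun_eq_coverGenFun {k l : ℕ} [NeZero k] [NeZero l]
    (A : Matrix (Fin k) (Fin l) ℝ) (n : ℕ) :
    aztecGenFun A n = coverGenFun true n (fun e => periodicArray A (e.1 - 1) (e.2 - 1)) := by
  classical
  unfold aztecGenFun matchingGenFun coverGenFun
  refine Finset.sum_bij (fun M _ => M.image (edgePos n)) ?_ ?_ ?_ ?_
  · intro M hM
    simp only [Finset.mem_filter, Finset.mem_univ, true_and, Finset.mem_powerset] at hM ⊢
    refine ⟨fun f hf => ?_, (isPerfectMatchingEdges_iff hM.1).1 hM⟩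
    obtain ⟨e, he, rfl⟩ := Finset.mem_image.1 hf
    exact edgePos_mem (hM.1 e he)
  · intro M hM M' hM' h
    simp only [Finset.mem_filter, Finset.mem_univ, true_and] at hM hM'
    have h' := congrArg (fun s : Finset (ℕ × ℕ) => (s : Set (ℕ × ℕ))) h
    simp only [Finset.coe_image] at h'
    exact_mod_cast ((edgePos_injOn n).image_eq_image_iff hM.1 hM'.1).1 h'
  · intro S hS
    simp only [Finset.mem_filter, Finset.mem_powerset] at hS
    have hM : ∀ e ∈ (Finset.univ.filter fun e =>
        e ∈ (aztecDiamond n).edgeSet ∧ edgePos n e ∈ S), e ∈ (aztecDiamond n).edgeSet :=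
      fun e he => (Finset.mem_filter.1 he).2.1
    have himg : (Finset.univ.filter fun e =>
        e ∈ (aztecDiamond n).edgeSet ∧ edgePos n e ∈ S).image (edgePos n) = S := by
      ext ⟨i, j⟩
      simp only [Finset.mem_image, Finset.mem_filter, Finset.mem_univ, true_and]
      constructor
      · rintro ⟨e, he, h⟩
        exact h ▸ he.2
      · intro h
        obtain ⟨e, he, h'⟩ := exists_edgePos (hS.1 h)
        exact ⟨e, ⟨he, h' ▸ h⟩, h'⟩
    refine ⟨_, ?_, himg⟩
    rw [Finset.mem_filter, isPerfectMatchingEdges_iff hM, himg]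
    exact ⟨Finset.mem_univ _, hS.2⟩
  · intro M hM
    simp only [Finset.mem_filter, Finset.mem_univ, true_and] at hM
    rw [Finset.prod_image fun e he f hf h => edgePos_injOn n (hM.1 e he) (hM.1 f hf) h]
    refine Finset.prod_congr rfl fun e _ => ?_
    induction e using Sym2.ind with
    | _ x y => simp [patternWeight, edgePos]

/-! ### The weight patterns under complementation -/

/-- The periodic weight with a `4 × 4` pattern, with positions numbered from `1`. -/
noncomputable def periodicWeight (A : Matrix (Fin 4) (Fin 4) ℝ) (e : ℕ × ℕ) : ℝ :=
  periodicArray A (e.1 - 1) (e.2 - 1)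

/-- The `4 × 4` weight pattern obtained from `patternB` by one complementation, up to scaling. -/
def patternMid (a b c d : ℝ) : Matrix (Fin 4) (Fin 4) ℝ :=
  !![a, d, c, b;
     c, b, a, d;
     d, a, b, c;
     b, c, d, a]

lemma periodicWeight_succ (A : Matrix (Fin 4) (Fin 4) ℝ) (i j : ℕ) :
    periodicWeight A (i + 1, j + 1) = A (Fin.ofNat 4 (i % 4)) (Fin.ofNat 4 (j % 4)) := by
  simp [periodicWeight, periodicArray, Fin.ofNat]

lemma cell_index_cases (I : ℕ) :
    (I % 2 = 0 ∧ 2 * I % 4 = 0 ∧ (2 * I + 1) % 4 = 1) ∨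
      (I % 2 = 1 ∧ 2 * I % 4 = 2 ∧ (2 * I + 1) % 4 = 3) := by
  omega

lemma cellFactor_periodicWeight (A : Matrix (Fin 4) (Fin 4) ℝ) (I J : ℕ) :
    cellFactor (periodicWeight A) I J =
      A (Fin.ofNat 4 (2 * I % 4)) (Fin.ofNat 4 (2 * J % 4)) *
        A (Fin.ofNat 4 ((2 * I + 1) % 4)) (Fin.ofNat 4 ((2 * J + 1) % 4)) +
      A (Fin.ofNat 4 (2 * I % 4)) (Fin.ofNat 4 ((2 * J + 1) % 4)) *
        A (Fin.ofNat 4 ((2 * I + 1) % 4)) (Fin.ofNat 4 (2 * J % 4)) := by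
  unfold cellFactor
  rw [periodicWeight_succ, periodicWeight_succ, periodicWeight_succ, periodicWeight_succ]

lemma cellFactor_patternB (a b c d : ℝ) (I J : ℕ) :
    cellFactor (periodicWeight (patternB a b c d)) I J =
      if (I + J) % 2 = 0 then a ^ 2 + b ^ 2 else c ^ 2 + d ^ 2 := by
  rw [cellFactor_periodicWeight, Nat.add_mod I J]
  rcases cell_index_cases I with ⟨h1, h2, h3⟩ | ⟨h1, h2, h3⟩ <;>
  rcases cell_index_cases J with ⟨h4, h5, h6⟩ | ⟨h4, h5, h6⟩ <;>
  rw [h1, h2, h3, h4, h5, h6] <;> simp [patternB, Fin.ofNat] <;> ring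

lemma cellFactor_patternMid (a b c d : ℝ) (I J : ℕ) :
    cellFactor (periodicWeight (patternMid a b c d)) I J = a * b + c * d := by
  rw [cellFactor_periodicWeight]
  rcases cell_index_cases I with ⟨h1, h2, h3⟩ | ⟨h1, h2, h3⟩ <;>
  rcases cell_index_cases J with ⟨h4, h5, h6⟩ | ⟨h4, h5, h6⟩ <;>
  rw [h2, h3, h5, h6] <;> simp [patternMid, Fin.ofNat] <;> ring

lemma stepWeight_periodicWeight (A : Matrix (Fin 4) (Fin 4) ℝ) (i j : ℕ) :
    stepWeight (periodicWeight A) (i + 1, j + 1) =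
      A (Fin.ofNat 4 ((mate (i + 2) - 1) % 4)) (Fin.ofNat 4 ((mate (j + 2) - 1) % 4)) /
        cellFactor (periodicWeight A) ((i + 1) / 2) ((j + 1) / 2) := by
  have h : ∀ i, mate (i + 2) = mate (i + 2) - 1 + 1 := by
    intro i; unfold mate; split_ifs <;> omega
  have e : stepWeight (periodicWeight A) (i + 1, j + 1) =
      periodicWeight A (mate (i + 2), mate (j + 2)) /
        cellFactor (periodicWeight A) ((i + 1) / 2) ((j + 1) / 2) := rfl
  rw [e, h i, h j, periodicWeight_succ]
  simp only [Nat.add_sub_cancel]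

/-- Modulo 4, the exchange inside cells followed by the unit shift fixes the indices 0 and 2 and
swaps 1 and 3. The last clause records the parity of the cell index, which selects the cell factor.
-/
lemma mate_cases (i : ℕ) :
    (i % 4 = 0 ∧ (mate (i + 2) - 1) % 4 = 0 ∧ (i + 1) / 2 % 2 = 0) ∨
      (i % 4 = 1 ∧ (mate (i + 2) - 1) % 4 = 3 ∧ (i + 1) / 2 % 2 = 1) ∨
      (i % 4 = 2 ∧ (mate (i + 2) - 1) % 4 = 2 ∧ (i + 1) / 2 % 2 = 1) ∨
      (i % 4 = 3 ∧ (mate (i + 2) - 1) % 4 = 1 ∧ (i + 1) / 2 % 2 = 0) := by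
  unfold mate; split_ifs <;> omega

lemma stepWeight_patternB (a b c d : ℝ) (i j : ℕ) :
    stepWeight (periodicWeight (patternB a b c d)) (i + 1, j + 1) =
      periodicWeight (patternMid (a / (a ^ 2 + b ^ 2)) (b / (a ^ 2 + b ^ 2))
        (c / (c ^ 2 + d ^ 2)) (d / (c ^ 2 + d ^ 2))) (i + 1, j + 1) := by
  rw [stepWeight_periodicWeight, cellFactor_patternB, periodicWeight_succ, Nat.add_mod]
  rcases mate_cases i with ⟨h1, h2, h3⟩ | ⟨h1, h2, h3⟩ | ⟨h1, h2, h3⟩ | ⟨h1, h2, h3⟩ <;>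
  rcases mate_cases j with ⟨h4, h5, h6⟩ | ⟨h4, h5, h6⟩ | ⟨h4, h5, h6⟩ | ⟨h4, h5, h6⟩ <;>
  rw [h1, h2, h3, h4, h5, h6] <;> simp [patternB, patternMid, Fin.ofNat]

lemma stepWeight_patternMid (a b c d : ℝ) (i j : ℕ) :
    stepWeight (periodicWeight (patternMid a b c d)) (i + 1, j + 1) =
      periodicWeight (patternB (a / (a * b + c * d)) (b / (a * b + c * d))
        (c / (a * b + c * d)) (d / (a * b + c * d))) (i + 1, j + 1) := by
  rw [stepWeight_periodicWeight, cellFactor_patternMid, periodicWeight_succ]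
  rcases mate_cases i with ⟨h1, h2, h3⟩ | ⟨h1, h2, h3⟩ | ⟨h1, h2, h3⟩ | ⟨h1, h2, h3⟩ <;>
  rcases mate_cases j with ⟨h4, h5, h6⟩ | ⟨h4, h5, h6⟩ | ⟨h4, h5, h6⟩ | ⟨h4, h5, h6⟩ <;>
  rw [h1, h2, h4, h5] <;> simp [patternB, patternMid, Fin.ofNat]

/-- Only positions with positive coordinates occur in the array; values at coordinate 0 are
artefacts of truncated subtraction. -/
lemma coverGenFun_congr {b : Bool} {n : ℕ} {w w' : ℕ × ℕ → ℝ}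
    (h : ∀ i j : ℕ, w (i + 1, j + 1) = w' (i + 1, j + 1)) :
    coverGenFun b n w = coverGenFun b n w' := by
  classical
  unfold coverGenFun
  refine Finset.sum_congr rfl fun S hS => Finset.prod_congr rfl ?_
  rintro ⟨i, j⟩ he
  have := Finset.mem_powerset.1 (Finset.mem_filter.1 hS).1 he
  simp only [edgeArray, Finset.mem_product, Finset.mem_Icc] at this
  convert h (i - 1) (j - 1) using 2 <;> rw [Prod.mk.injEq] <;> omega

/-! ### Products of the alternating cell factors -/

lemma prod_checkerboard_row (u v : ℝ) (i l : ℕ) :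
    ∏ j ∈ Finset.range (2 * l), (if (i + j) % 2 = 0 then u else v) = (u * v) ^ l := by
  induction l with
  | zero => simp
  | succ l ih =>
    rw [mul_add, mul_one, Finset.prod_range_succ, Finset.prod_range_succ, ih, pow_succ, mul_assoc]
    congr 1
    by_cases h : i % 2 = 0
    · rw [if_pos (by omega), if_neg (by omega)]
    · rw [if_neg (by omega), if_pos (by omega), mul_comm]

lemma prod_checkerboard_even (u v : ℝ) (l : ℕ) :
    ∏ c : Fin (2 * l) × Fin (2 * l), (if (c.1.val + c.2.val) % 2 = 0 then u else v) =
      (u * v) ^ (2 * l ^ 2) := by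
  rw [Fintype.prod_prod_type]
  simp only
  simp_rw [fun i : Fin (2 * l) => (Finset.prod_range
    (fun j => if (i.val + j) % 2 = 0 then u else v)).symm.trans (prod_checkerboard_row u v i l)]
  rw [Finset.prod_const, Finset.card_univ, Fintype.card_fin, ← pow_mul]
  congr 1
  ring

lemma prod_checkerboard_odd (u v : ℝ) (l : ℕ) :
    ∏ c : Fin (2 * l + 1) × Fin (2 * l + 1), (if (c.1.val + c.2.val) % 2 = 0 then u else v) =
      u ^ (2 * l ^ 2 + 2 * l + 1) * v ^ (2 * l ^ 2 + 2 * l) := by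
  rw [Fintype.prod_prod_type]
  simp only
  -- Each row leaves one unpaired factor, in the last column; as `2 * l` is even, these leftovers
  -- themselves form an alternating line.
  have row : ∀ i : Fin (2 * l + 1),
      ∏ j : Fin (2 * l + 1), (if (i.val + j.val) % 2 = 0 then u else v) =
        (u * v) ^ l * (if (0 + i.val) % 2 = 0 then u else v) := by
    intro i
    rw [← Finset.prod_range (fun j => if (i.val + j) % 2 = 0 then u else v),
      Finset.prod_range_succ, prod_checkerboard_row]
    congr 2
    rw [eq_iff_iff]
    omega
  simp_rw [row]
  rw [Finset.prod_mul_distrib, Finset.prod_const, Finset.card_univ, Fintype.card_fin,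
    ← Finset.prod_range (fun i => if (0 + i) % 2 = 0 then u else v), Finset.prod_range_succ,
    prod_checkerboard_row, if_pos (by omega)]
  ring

/-! ### The two-step recurrence and the induction -/

lemma coverGenFun_patternB_add_two {a b c d : ℝ} (ha : 0 < a) (hb : 0 < b) (hc : 0 < c)
    (hd : 0 < d) {u v D : ℝ} (hu : u = a ^ 2 + b ^ 2) (hv : v = c ^ 2 + d ^ 2)
    (hD : D = a / u * (b / u) + c / v * (d / v)) (n : ℕ) :
    coverGenFun true (n + 2) (periodicWeight (patternB a b c d)) =
      (∏ e : Fin (n + 2) × Fin (n + 2), if (e.1.val + e.2.val) % 2 = 0 then u else v) *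
        D ^ ((n + 1) ^ 2) * coverGenFun true n
          (periodicWeight (patternB (a / u / D) (b / u / D) (c / v / D) (d / v / D))) := by
  have hu0 : 0 < u := by rw [hu]; positivity
  have hv0 : 0 < v := by rw [hv]; positivity
  have hD0 : 0 < D := by rw [hD]; positivity
  rw [coverGenFun_succ (n + 1), coverGenFun_congr (stepWeight_patternB a b c d),
    coverGenFun_succ n, coverGenFun_congr (stepWeight_patternMid _ _ _ _)]
  · simp only [cellFactor_patternB, cellFactor_patternMid, ← hu, ← hv, ← hD]
    rw [Finset.prod_const, Finset.card_univ, Fintype.card_prod, Fintype.card_fin, ← sq, mul_assoc]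
  · intro I J
    rw [cellFactor_patternMid, ← hu, ← hv, ← hD]
    exact hD0.ne'
  · intro I J
    rw [cellFactor_patternB, ← hu, ← hv]
    split_ifs
    · exact hu0.ne'
    · exact hv0.ne'

lemma coverGenFun_patternB_one {a b c d : ℝ} (ha : 0 < a) (hc : 0 < c) :
    coverGenFun true 1 (periodicWeight (patternB a b c d)) = a ^ 2 + b ^ 2 := by
  rw [coverGenFun_succ 0, coverGenFun_zero]
  · simp [cellFactor_patternB]
  · intro I J
    rw [cellFactor_patternB]
    split_ifs <;> positivity

/-- Each of the four identities compares exponents in one two-step reduction, named after the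
residue mod 4 of the smaller order. The left side is the recurrence factor times the formula at the
new parameters; the right side is the target with `P = D u² v²`. -/
lemma power_identity_zero {u v D Q : ℝ} (hu : 0 < u) (hv : 0 < v) (hD : 0 < D) (k : ℕ) :
    (u * v) ^ (2 * (2 * k + 1) ^ 2) * D ^ ((4 * k + 1) ^ 2) *
      ((Q / (u ^ 2 * v ^ 2 * D ^ 6)) ^ (k * (2 * k + 1)) * (1 / D) ^ (k * (2 * k - 1))) =
    (D * u ^ 2 * v ^ 2) ^ (k * (2 * k + 3) + 1) * Q ^ (k * (2 * k + 1)) := by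
  -- Naming this exponent removes the truncated subtraction: since `m + k = 2 k²` also for `k = 0`,
  -- all exponents become linear in `m` and `k`.
  obtain ⟨m, hm⟩ : ∃ m, m = k * (2 * k - 1) := ⟨_, rfl⟩
  have h2 : m + k = 2 * k ^ 2 := by
    rcases k with _ | k
    · simp [hm]
    · rw [hm, show 2 * (k + 1) - 1 = 2 * k + 1 by omega]; ring
  rw [← hm, show k * (2 * k + 1) = m + 2 * k by linarith,
    show k * (2 * k + 3) + 1 = m + 4 * k + 1 by linarith,
    show 2 * (2 * k + 1) ^ 2 = 4 * m + 12 * k + 2 by linarith,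
    show (4 * k + 1) ^ 2 = 8 * m + 16 * k + 1 by linarith]
  simp only [div_pow, one_pow]
  field_simp
  ring

lemma power_identity_one {u v D Q : ℝ} (hu : 0 < u) (hv : 0 < v) (hD : 0 < D) (k : ℕ) :
    u ^ (2 * (2 * k + 1) ^ 2 + 2 * (2 * k + 1) + 1) * v ^ (2 * (2 * k + 1) ^ 2 + 2 * (2 * k + 1)) *
      D ^ ((4 * k + 2) ^ 2) *
      (1 / (u * D ^ 2) * (Q / (u ^ 2 * v ^ 2 * D ^ 6)) ^ (k * (2 * k + 2)) *
        (1 / D) ^ (2 * k ^ 2)) =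
    (D * u ^ 2 * v ^ 2) ^ (k * (2 * k + 4) + 2) * Q ^ (k * (2 * k + 2)) := by
  simp only [div_pow, one_pow]
  field_simp
  ring

lemma power_identity_two {u v D Q : ℝ} (hu : 0 < u) (hv : 0 < v) (hD : 0 < D) (k : ℕ) :
    (u * v) ^ (2 * (2 * k + 2) ^ 2) * D ^ ((4 * k + 3) ^ 2) *
      ((Q / (u ^ 2 * v ^ 2 * D ^ 6)) ^ (k * (2 * k + 3) + 1) * (1 / D) ^ (k * (2 * k + 1))) =
    (D * u ^ 2 * v ^ 2) ^ ((k + 1) * (2 * k + 3)) * Q ^ ((k + 1) * (2 * k + 1)) := by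
  simp only [div_pow, one_pow]
  field_simp
  ring

lemma power_identity_three {u v D Q : ℝ} (hu : 0 < u) (hv : 0 < v) (hD : 0 < D) (k : ℕ) :
    u ^ (2 * (2 * k + 2) ^ 2 + 2 * (2 * k + 2) + 1) * v ^ (2 * (2 * k + 2) ^ 2 + 2 * (2 * k + 2)) *
      D ^ ((4 * k + 4) ^ 2) *
      ((Q / (u ^ 2 * v ^ 2 * D ^ 6)) ^ (k * (2 * k + 4) + 2) * (1 / D) ^ (k * (2 * k + 2))) =
    u * (D * u ^ 2 * v ^ 2) ^ ((k + 1) * (2 * k + 4)) * Q ^ (2 * (k + 1) ^ 2) := by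
  simp only [div_pow, one_pow]
  field_simp
  ring

/-- The parameters are quantified inside the induction because each reduction changes them. -/
lemma coverGenFun_patternB (k : ℕ) : ∀ a b c d : ℝ, 0 < a → 0 < b → 0 < c → 0 < d →
    ∀ P : ℝ, P = a * b * (c ^ 2 + d ^ 2) ^ 2 + c * d * (a ^ 2 + b ^ 2) ^ 2 →
    coverGenFun true (4 * k) (periodicWeight (patternB a b c d)) =
        P ^ (k * (2 * k + 1)) * (a * b + c * d) ^ (k * (2 * k - 1)) ∧
      coverGenFun true (4 * k + 1) (periodicWeight (patternB a b c d)) =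
        (a ^ 2 + b ^ 2) * P ^ (k * (2 * k + 2)) * (a * b + c * d) ^ (2 * k ^ 2) ∧
      coverGenFun true (4 * k + 2) (periodicWeight (patternB a b c d)) =
        P ^ (k * (2 * k + 3) + 1) * (a * b + c * d) ^ (k * (2 * k + 1)) ∧
      coverGenFun true (4 * k + 3) (periodicWeight (patternB a b c d)) =
        P ^ (k * (2 * k + 4) + 2) * (a * b + c * d) ^ (k * (2 * k + 2)) := by
  -- The new parameters enter the formulas only through `a'² + b'²`, `Q'` and `P'`, so these three
  -- values are all that is recorded besides positivity and the recurrence.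
  have reduced : ∀ a b c d : ℝ, 0 < a → 0 < b → 0 < c → 0 < d → ∃ u v D Q a' b' c' d' : ℝ,
      0 < u ∧ 0 < v ∧ 0 < D ∧ u = a ^ 2 + b ^ 2 ∧ Q = a * b + c * d ∧
      D * u ^ 2 * v ^ 2 = a * b * (c ^ 2 + d ^ 2) ^ 2 + c * d * (a ^ 2 + b ^ 2) ^ 2 ∧
      0 < a' ∧ 0 < b' ∧ 0 < c' ∧ 0 < d' ∧ a' ^ 2 + b' ^ 2 = 1 / (u * D ^ 2) ∧
      a' * b' + c' * d' = 1 / D ∧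
      Q / (u ^ 2 * v ^ 2 * D ^ 6) =
        a' * b' * (c' ^ 2 + d' ^ 2) ^ 2 + c' * d' * (a' ^ 2 + b' ^ 2) ^ 2 ∧
      ∀ n, coverGenFun true (n + 2) (periodicWeight (patternB a b c d)) =
        (∏ e : Fin (n + 2) × Fin (n + 2), if (e.1.val + e.2.val) % 2 = 0 then u else v) *
          D ^ ((n + 1) ^ 2) * coverGenFun true n (periodicWeight (patternB a' b' c' d')) := by
    intro a b c d ha hb hc hd
    obtain ⟨u, hu⟩ : ∃ u, u = a ^ 2 + b ^ 2 := ⟨_, rfl⟩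
    obtain ⟨v, hv⟩ : ∃ v, v = c ^ 2 + d ^ 2 := ⟨_, rfl⟩
    obtain ⟨D, hD⟩ : ∃ D, D = a / u * (b / u) + c / v * (d / v) := ⟨_, rfl⟩
    have hu0 : 0 < u := by rw [hu]; positivity
    have hv0 : 0 < v := by rw [hv]; positivity
    have hD0 : 0 < D := by rw [hD]; positivity
    have h1 : (a / u / D) ^ 2 + (b / u / D) ^ 2 = 1 / (u * D ^ 2) := by
      have : (a / u / D) ^ 2 + (b / u / D) ^ 2 = (a ^ 2 + b ^ 2) / (u ^ 2 * D ^ 2) := by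
        field_simp
      rw [this, ← hu]
      field_simp
    have h2 : (c / v / D) ^ 2 + (d / v / D) ^ 2 = 1 / (v * D ^ 2) := by
      have : (c / v / D) ^ 2 + (d / v / D) ^ 2 = (c ^ 2 + d ^ 2) / (v ^ 2 * D ^ 2) := by
        field_simp
      rw [this, ← hv]
      field_simp
    refine ⟨u, v, D, a * b + c * d, a / u / D, b / u / D, c / v / D, d / v / D, hu0, hv0, hD0, hu,
      rfl, ?_, by positivity, by positivity, by positivity, by positivity, h1, ?_, ?_,
      coverGenFun_patternB_add_two ha hb hc hd hu hv hD⟩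
    · rw [← hu, ← hv, hD]
      field_simp
    · have : a / u / D * (b / u / D) + c / v / D * (d / v / D) =
          (a / u * (b / u) + c / v * (d / v)) / D ^ 2 := by ring
      rw [this, ← hD]
      field_simp
    · rw [h1, h2]
      field_simp
  -- Half an induction step: orders `4k`, `4k + 1` yield `4k + 2`, `4k + 3`. The other half, up to
  -- `4k + 4`, `4k + 5`, is `base` in the successor case.
  have step : ∀ k : ℕ, (∀ a b c d : ℝ, 0 < a → 0 < b → 0 < c → 0 < d →
    ∀ P : ℝ, P = a * b * (c ^ 2 + d ^ 2) ^ 2 + c * d * (a ^ 2 + b ^ 2) ^ 2 →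
    coverGenFun true (4 * k) (periodicWeight (patternB a b c d)) =
        P ^ (k * (2 * k + 1)) * (a * b + c * d) ^ (k * (2 * k - 1)) ∧
      coverGenFun true (4 * k + 1) (periodicWeight (patternB a b c d)) =
        (a ^ 2 + b ^ 2) * P ^ (k * (2 * k + 2)) * (a * b + c * d) ^ (2 * k ^ 2)) →
    ∀ a b c d : ℝ, 0 < a → 0 < b → 0 < c → 0 < d →
    ∀ P : ℝ, P = a * b * (c ^ 2 + d ^ 2) ^ 2 + c * d * (a ^ 2 + b ^ 2) ^ 2 →
    coverGenFun true (4 * k + 2) (periodicWeight (patternB a b c d)) =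
        P ^ (k * (2 * k + 3) + 1) * (a * b + c * d) ^ (k * (2 * k + 1)) ∧
      coverGenFun true (4 * k + 3) (periodicWeight (patternB a b c d)) =
        P ^ (k * (2 * k + 4) + 2) * (a * b + c * d) ^ (k * (2 * k + 2)) := by
    intro k ih a b c d ha hb hc hd P hP
    obtain ⟨u, v, D, Q, a', b', c', d', hu, hv, hD, hu', hQ, hP', ha', hb', hc', hd', e1, e2, e3,
      hrec⟩ := reduced a b c d ha hb hc hd
    obtain ⟨i0, i1⟩ := ih a' b' c' d' ha' hb' hc' hd' _ e3
    rw [← hP'] at hP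
    rw [e2] at i0
    rw [e1, e2] at i1
    rw [hrec (4 * k), show 4 * k + 3 = 4 * k + 1 + 2 from rfl, hrec (4 * k + 1), i0, i1, hP, ← hQ,
      ← power_identity_zero hu hv hD, ← power_identity_one hu hv hD,
      show 4 * k + 2 = 2 * (2 * k + 1) by ring, prod_checkerboard_even,
      show 4 * k + 1 + 2 = 2 * (2 * k + 1) + 1 by ring, prod_checkerboard_odd]
    exact ⟨rfl, by ring⟩
  induction k with
  | zero =>
    have base : ∀ a b c d : ℝ, 0 < a → 0 < b → 0 < c → 0 < d →
        ∀ P : ℝ, P = a * b * (c ^ 2 + d ^ 2) ^ 2 + c * d * (a ^ 2 + b ^ 2) ^ 2 →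
        coverGenFun true (4 * 0) (periodicWeight (patternB a b c d)) =
            P ^ (0 * (2 * 0 + 1)) * (a * b + c * d) ^ (0 * (2 * 0 - 1)) ∧
          coverGenFun true (4 * 0 + 1) (periodicWeight (patternB a b c d)) =
            (a ^ 2 + b ^ 2) * P ^ (0 * (2 * 0 + 2)) * (a * b + c * d) ^ (2 * 0 ^ 2) := by
      intro a b c d ha hb hc hd P hP
      simp [coverGenFun_zero, coverGenFun_patternB_one ha hc]
    intro a b c d ha hb hc hd P hP
    exact ⟨(base a b c d ha hb hc hd P hP).1, (base a b c d ha hb hc hd P hP).2,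
      step 0 base a b c d ha hb hc hd P hP⟩
  | succ k ih =>
    have base : ∀ a b c d : ℝ, 0 < a → 0 < b → 0 < c → 0 < d →
        ∀ P : ℝ, P = a * b * (c ^ 2 + d ^ 2) ^ 2 + c * d * (a ^ 2 + b ^ 2) ^ 2 →
        coverGenFun true (4 * (k + 1)) (periodicWeight (patternB a b c d)) =
            P ^ ((k + 1) * (2 * (k + 1) + 1)) *
              (a * b + c * d) ^ ((k + 1) * (2 * (k + 1) - 1)) ∧
          coverGenFun true (4 * (k + 1) + 1) (periodicWeight (patternB a b c d)) =
            (a ^ 2 + b ^ 2) * P ^ ((k + 1) * (2 * (k + 1) + 2)) *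
              (a * b + c * d) ^ (2 * (k + 1) ^ 2) := by
      intro a b c d ha hb hc hd P hP
      obtain ⟨u, v, D, Q, a', b', c', d', hu, hv, hD, hu', hQ, hP', ha', hb', hc', hd', e1, e2, e3,
        hrec⟩ := reduced a b c d ha hb hc hd
      obtain ⟨-, -, i2, i3⟩ := ih a' b' c' d' ha' hb' hc' hd' _ e3
      rw [← hP'] at hP
      rw [e2] at i2 i3
      rw [show 2 * (k + 1) - 1 = 2 * k + 1 by omega, show 2 * (k + 1) + 1 = 2 * k + 3 by ring,
        show 2 * (k + 1) + 2 = 2 * k + 4 by ring, hP, ← hQ, ← hu',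
        ← power_identity_two hu hv hD, ← power_identity_three hu hv hD,
        show 4 * (k + 1) = 4 * k + 2 + 2 by ring, hrec (4 * k + 2),
        show 4 * k + 2 + 2 + 1 = 4 * k + 3 + 2 by ring, hrec (4 * k + 3), i2, i3,
        show 4 * k + 2 + 2 = 2 * (2 * k + 2) by ring, prod_checkerboard_even,
        show 4 * k + 3 + 2 = 2 * (2 * k + 2) + 1 by ring, prod_checkerboard_odd]
      exact ⟨rfl, by ring⟩
    intro a b c d ha hb hc hd P hP
    exact ⟨(base a b c d ha hb hc hd P hP).1, (base a b c d ha hb hc hd P hP).2,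
      step (k + 1) base a b c d ha hb hc hd P hP⟩

theorem theorem5p2 (a b c d : ℝ) (ha : 0 < a) (hb : 0 < b) (hc : 0 < c) (hd : 0 < d)
    (P : ℝ) (hP : P = a * b * (c ^ 2 + d ^ 2) ^ 2 + c * d * (a ^ 2 + b ^ 2) ^ 2) (k : ℕ) :
    aztecGenFun (patternB a b c d) (4 * k) =
        P ^ (k * (2 * k + 1)) * (a * b + c * d) ^ (k * (2 * k - 1)) ∧
      aztecGenFun (patternB a b c d) (4 * k + 1) =
        (a ^ 2 + b ^ 2) * P ^ (k * (2 * k + 2)) * (a * b + c * d) ^ (2 * k ^ 2) ∧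
      aztecGenFun (patternB a b c d) (4 * k + 2) =
        P ^ (k * (2 * k + 3) + 1) * (a * b + c * d) ^ (k * (2 * k + 1)) ∧
      aztecGenFun (patternB a b c d) (4 * k + 3) =
        P ^ (k * (2 * k + 4) + 2) * (a * b + c * d) ^ (k * (2 * k + 2)) := by
  simp only [aztecGenFun_eq_coverGenFun]
  exact coverGenFun_patternB k a b c d ha hb hc hd P hP
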